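/- **Setting.** Let $X,Y$ be (real or complex) Hilbert spaces and $T:X\to Y$ a compact injective linear operator. Let $\{E_\lambda\}$ be the spectral family of $T^*T$ and write $f(T^*T)=\int f(\lambda)\,dE_\lambda$. Let $0<\alpha_0\le\|T\|^2$, let $g_\alpha:[0,\|T\|^2]\to\mathbb R$ for $\alpha\in(0,\alpha_0)$, and put $r_\alpha(\lambda)=1-\lambda g_\alpha(\lambda)$ and $R_\alpha=g_\alpha(T^*T)T^*$. The parameter $\alpha$ always ranges over $(0,\alpha_0)$. Assume: * **H1.** Each $g_\alpha$ is piecewise continuous on $[0,\|T\|^2]$. * **H2.** There is $C>0$ with $|\lambda g_\alpha(\lambda)|\le C$ for all $\alpha$ and all $\lambda\in[0,\|T\|^2]$. * **H3.** $\lim_{\alpha\to0^+}g_\alpha(\lambda)=1/\lambda$ for every $\lambda\in(0,\|T\|^2]$. * **H4.** $\sup_{\lambda\in[0,\|T\|^2]}\sqrt\lambda\,|g_\alpha(\lambda)|=O(1/\sqrt\alpha)$ as $\alpha\to0^+$. * **M1.** There are positive eigenvalues $\tilde\lambda_n$ $(n\ge1)$ of $TT^*$ and $c\ge1$ such that $\tilde\lambda_n\downarrow0$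 and $\tilde\lambda_n/\tilde\lambda_{n+1}\le c$ for all $n$. * **M2.** There are positive constants $\lambda_1\le\|T\|^2$, $\gamma_1,\gamma_2$ and $c_1>1$ such that (a) $0\le r_\alpha(\lambda)\le1$ for $0\le\lambda\le\lambda_1$; (b) $r_\alpha(\lambda)\ge\gamma_1$ for $0\le\lambda<\alpha\le\lambda_1$; (c) for each $\lambda\in(0,\|T\|^2]$, $|r_\alpha(\lambda)|$ is non-decreasing in $\alpha$; (d) $g_\alpha(c_1\alpha)\ge\gamma_2/\alpha$ for $0<c_1\alpha\le\lambda_1$; (e) $g_\alpha(\lambda)\ge g_\alpha(\tilde\lambda)$ for $0<\alpha\le\lambda\le\tilde\lambda\le\lambda_1$. * **M3.** $\rho:(0,\|T\|^2]\to(0,\infty)$ is continuous and strictly increasing, $\lim_{t\to0^+}\rho(t)=0$, and (a) $\rho$ is of local upper type $\beta$ for some $\beta\ge0$: there is $d>0$ with $\rho(t)\le d\,s^{-\beta}\rho(st)$ for all $s\in(0,1]$, $t\in(0,\|T\|^2]$; (b) $\rho$ is a maximal qualification of $\{R_\alpha\}$: there is $\gamma>0$ with $\sup_{\lambda\in(0,\|T\|^2]}|r_\alpha(\lambda)|\rho(\lambda)\le\gamma\rho(\alpha)$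 for all $\alpha$, and for every $\lambda\in(0,\|T\|^2]$ we have $\inf_{\alpha\in(0,\alpha_0)}|r_\alpha(\lambda)|/\rho(\alpha)>0$; (c) there are $a,k>0$ with $\rho(\lambda)|r_\alpha(\lambda)|/\rho(\alpha)\ge a$ whenever $0<k\alpha\le\lambda\le\|T\|^2$. * **M4.** For every $\alpha$, the function $\lambda\mapsto|r_\alpha(\lambda)|^2$ is convex on $(0,\|T\|^2]$. Let $\Theta(t)=\sqrt t\,\rho(t)$ for $t\in(0,\|T\|^2]$, and let $\overline{B_\delta(Tx)}=\{y\in Y:\|Tx-y\|\le\delta\}$. **Lemma.** If for some $x\in X$ $$\sup_{y^\delta\in\overline{B_\delta(Tx)}}\ \inf_{\alpha\in(0,\alpha_0)}\|R_\alpha y^\delta-x\|=O\big(\rho(\Theta^{-1}(\delta))\big)\qquad(\delta\to0^+),$$ then $x\in\mathcal R(\rho(T^*T))$, the range of $\rho(T^*T)$. -/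

import Mathlib

open Set Filter Topology Asymptotics

namespace SpectralReg

/-- `f` is piecewise continuous on `[a, b]`: it is continuous on `[a, b]` off a finite set, and at
every point of `[a, b]` it has finite one-sided limits from within `[a, b]`. (At an end point the
filter of the missing side is `⊥`, so that side imposes nothing.) -/
def PiecewiseContinuousOn (f : ℝ → ℝ) (a b : ℝ) : Prop :=
  (∃ S : Set ℝ, S.Finite ∧ ∀ t ∈ Icc a b \ S, ContinuousWithinAt f (Icc a b) t) ∧
    ∀ t ∈ Icc a b,
      (∃ l : ℝ, Tendsto f (𝓝[Icc a b ∩ Iio t] t) (𝓝 l)) ∧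
      (∃ l : ℝ, Tendsto f (𝓝[Icc a b ∩ Ioi t] t) (𝓝 l))

/-- The residual function `r_α(t) = 1 - t g_α(t)`. -/
def resid (g : ℝ → ℝ → ℝ) (α t : ℝ) : ℝ := 1 - t * g α t

/-- The standing hypotheses on a family `(g_α)`, `0 < α < α₀`, of real functions on `[0, N]`
(later `N = ‖T‖ ^ 2`): each `g_α` is piecewise continuous, `|t g_α(t)|` is bounded uniformly in
`α` and `t`, `g_α(t) → 1 / t` as `α → 0+` for each `t ∈ (0, N]`, and
`sup_t √t |g_α(t)| = O(1 / √α)` as `α → 0+`. -/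
structure IsRegularizingFamily (N α₀ : ℝ) (g : ℝ → ℝ → ℝ) : Prop where
  piecewise_continuous : ∀ α ∈ Ioo 0 α₀, PiecewiseContinuousOn (g α) 0 N
  bounded : ∃ C : ℝ, 0 < C ∧ ∀ α ∈ Ioo 0 α₀, ∀ t ∈ Icc 0 N, |t * g α t| ≤ C
  tendsto_inv : ∀ t ∈ Ioc 0 N, Tendsto (fun α => g α t) (𝓝[>] 0) (𝓝 (1 / t))
  growth : ∃ K : ℝ, ∀ᶠ α in 𝓝[>] (0 : ℝ), ∀ t ∈ Icc 0 N, √t * |g α t| ≤ K / √α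

/-- `ρ : (0, N] → (0, ∞)` is a qualification of the family: `ρ` is increasing and
`sup_{t ∈ (0, N]} |r_α(t)| ρ(t) ≤ γ ρ(α)` for all `α ∈ (0, α₀)`. -/
structure IsQualification (N α₀ : ℝ) (g : ℝ → ℝ → ℝ) (ρ : ℝ → ℝ) : Prop where
  pos : ∀ t ∈ Ioc 0 N, 0 < ρ t
  mono : MonotoneOn ρ (Ioc 0 N)
  le : ∃ γ : ℝ, 0 < γ ∧ ∀ α ∈ Ioo 0 α₀, ∀ t ∈ Ioc 0 N, |resid g α t| * ρ t ≤ γ * ρ α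

/-- `ρ` is a maximal qualification: it is a qualification, and for every `t ∈ (0, N]` there is
`c = c(t) > 0` with `inf_{α ∈ (0, α₀)} |r_α(t)| / ρ(α) ≥ c`. -/
structure IsMaximalQualification (N α₀ : ℝ) (g : ℝ → ℝ → ℝ) (ρ : ℝ → ℝ) : Prop
    extends IsQualification N α₀ g ρ where
  maximal : ∀ t ∈ Ioc 0 N, ∃ c : ℝ, 0 < c ∧ ∀ α ∈ Ioo 0 α₀, c ≤ |resid g α t| / ρ α

/-- `ρ : (0, a] → (0, ∞)` is of local upper type `β ≥ 0`: it is continuous, non-decreasing,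
tends to `0` at `0+`, and `ρ(t) ≤ d (1 / s) ^ β ρ(s t)` for `s ∈ (0, 1]` and `t ∈ (0, a]`. -/
structure IsLocalUpperType (ρ : ℝ → ℝ) (a β : ℝ) : Prop where
  nonneg : 0 ≤ β
  pos : ∀ t ∈ Ioc 0 a, 0 < ρ t
  continuousOn : ContinuousOn ρ (Ioc 0 a)
  mono : MonotoneOn ρ (Ioc 0 a)
  tendsto_zero : Tendsto ρ (𝓝[>] 0) (𝓝 0)
  le : ∃ d : ℝ, 0 < d ∧ ∀ s ∈ Ioc (0 : ℝ) 1, ∀ t ∈ Ioc 0 a, ρ t ≤ d * (1 / s) ^ β * ρ (s * t)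

/-- The conditions on the residuals near `t = 0`, with constants `0 < l₁ ≤ N`, `γ₁, γ₂ > 0`
and `c₁ > 1`; the parameter `α` always ranges over `(0, α₀)`. -/
def ResidualConditions (N α₀ : ℝ) (g : ℝ → ℝ → ℝ) : Prop :=
  ∃ l₁ γ₁ γ₂ c₁ : ℝ, 0 < l₁ ∧ l₁ ≤ N ∧ 0 < γ₁ ∧ 0 < γ₂ ∧ 1 < c₁ ∧
    (∀ α ∈ Ioo 0 α₀, ∀ t ∈ Icc 0 l₁, 0 ≤ resid g α t ∧ resid g α t ≤ 1) ∧
    (∀ α ∈ Ioo 0 α₀, ∀ t : ℝ, 0 ≤ t → t < α → α ≤ l₁ → γ₁ ≤ resid g α t) ∧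
    (∀ t ∈ Ioc 0 N, MonotoneOn (fun α => |resid g α t|) (Ioo 0 α₀)) ∧
    (∀ α ∈ Ioo 0 α₀, c₁ * α ≤ l₁ → γ₂ / α ≤ g α (c₁ * α)) ∧
    (∀ α ∈ Ioo 0 α₀, ∀ s t : ℝ, α ≤ s → s ≤ t → t ≤ l₁ → g α t ≤ g α s)

/-- `ρ` is a strictly increasing maximal qualification of local upper type `β` for some `β ≥ 0`,
and there are `a, k > 0` with `ρ(t) |r_α(t)| / ρ(α) ≥ a` whenever `0 < k α ≤ t ≤ N`. -/
def QualificationConditions (N α₀ : ℝ) (g : ℝ → ℝ → ℝ) (ρ : ℝ → ℝ) : Prop :=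
  StrictMonoOn ρ (Ioc 0 N) ∧ (∃ β : ℝ, IsLocalUpperType ρ N β) ∧
    IsMaximalQualification N α₀ g ρ ∧
    ∃ a k : ℝ, 0 < a ∧ 0 < k ∧
      ∀ α ∈ Ioo 0 α₀, ∀ t : ℝ, k * α ≤ t → t ≤ N → a ≤ ρ t * |resid g α t| / ρ α

/-- `Θ(t) = √t ρ(t)`. -/
noncomputable def Theta (ρ : ℝ → ℝ) (t : ℝ) : ℝ := √t * ρ t

/-- The inverse of `Θ : (0, N] → ℝ`; its values matter only on the image `Θ((0, N])`. -/
noncomputable def ThetaInv (ρ : ℝ → ℝ) (N : ℝ) : ℝ → ℝ :=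
  Function.invFunOn (Theta ρ) (Ioc 0 N)

section Operators

variable {𝕜 X Y : Type*} [RCLike 𝕜]
  [NormedAddCommGroup X] [InnerProductSpace 𝕜 X] [CompleteSpace X]
  [NormedAddCommGroup Y] [InnerProductSpace 𝕜 Y] [CompleteSpace Y]

/-- Eigenspaces of a bounded operator are closed, hence complete. -/
instance instCompleteSpaceEigenspace (A : X →L[𝕜] X) (μ : 𝕜) :
    CompleteSpace (Module.End.eigenspace (A : X →ₗ[𝕜] X) μ) := by
  have h : Module.End.eigenspace (A : X →ₗ[𝕜] X) μ
      = LinearMap.ker ((A - μ • ContinuousLinearMap.id 𝕜 X : X →L[𝕜] X) : X →ₗ[𝕜] X) := by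
    ext v
    simp [sub_eq_zero]
  rw [h]
  exact (ContinuousLinearMap.isClosed_ker _).completeSpace_coe

/-- The orthogonal projection onto the eigenspace `ker (A - μ)`; it is `0` if `μ` is not an
eigenvalue. -/
noncomputable def eigenProj (A : X →L[𝕜] X) (μ : ℝ) : X →L[𝕜] X :=
  (Module.End.eigenspace (A : X →ₗ[𝕜] X) (μ : 𝕜)).starProjection

/-- The vector `f(A) x = ∫ f(μ) dE_μ x` for a compact self-adjoint operator `A` with spectral
family `E`. The spectral measure of such an operator is purely atomic, with mass `eigenProj A μ`
at `μ`, so the spectral integral is the orthogonal series `∑ μ, f(μ) • eigenProj A μ x` over the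
eigenvalues `μ`. The series converges for every `x` if `f` is bounded on the set of eigenvalues,
which is the case for all functions to which it is applied below. -/
noncomputable def spectralApply (A : X →L[𝕜] X) (f : ℝ → ℝ) (x : X) : X :=
  ∑' μ : ℝ, ((f μ : ℝ) : 𝕜) • eigenProj A μ x

/-- The operator `T* T`. -/
noncomputable def normalOp (T : X →L[𝕜] Y) : X →L[𝕜] X :=
  (ContinuousLinearMap.adjoint T).comp T

/-- The spectral regularization operator `R_α = g_α(T* T) T*`. -/
noncomputable def regOp (T : X →L[𝕜] Y) (g : ℝ → ℝ → ℝ) (α : ℝ) (y : Y) : X :=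
  spectralApply (normalOp T) (g α) (ContinuousLinearMap.adjoint T y)

/-- There are eigenvalues `ev n > 0` of `T T*` with `ev n ↓ 0` and bounded ratios
`ev n / ev (n + 1) ≤ c`, `c ≥ 1`. -/
def EigenvalueCondition (T : X →L[𝕜] Y) : Prop :=
  ∃ (ev : ℕ → ℝ) (c : ℝ), 1 ≤ c ∧
    (∀ n, Module.End.HasEigenvalue
      ((T.comp (ContinuousLinearMap.adjoint T) : Y →L[𝕜] Y) : Y →ₗ[𝕜] Y) ((ev n : ℝ) : 𝕜)) ∧
    (∀ n, 0 < ev n) ∧ Antitone ev ∧ Tendsto ev atTop (𝓝 0) ∧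
    ∀ n, ev n / ev (n + 1) ≤ c

end Operators

end SpectralReg

open SpectralReg

/-!
The argument has two halves, linked by the residual estimate `‖r_a(T* T) x‖ ≤ C' ρ(a)` along the
eigenvalues `a = ev n` of `T T*`.

*From the error to the residual.* Perturb the exact data by `y = T x ± δ v`, with `v` a unit
eigenvector of `T T*` for the eigenvalue `a`. The error `R_α y - x` is `-r_α(T* T) x` plus a multiple
of the eigenvector `T* v`, of norm `δ g_α(a) √a`. Since `r_α(a)` and `g_α(a)` are nonnegative for
small `a`, one choice of the sign, the same for all `α`, makes the cross term harmless, so the error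
dominates each of the two parts (`error_lower_bounds`). The residual is non-decreasing and `g_α(a)`
is non-increasing in `α`, and `g_a(a) ≥ γ₂ / a`; so the best error over all `α` is at least
`min (‖r_a(T* T) x‖, γ₂ δ / √a)` (`min_le_worst_error`). Take `δ = Θ(K a)`: the hypothesis bounds
this minimum by `C ρ(K a)`, while the second term equals `γ₂ √K ρ(K a)`, which is larger when
`γ₂² K > C²`. Hence `‖r_a(T* T) x‖ ≤ C ρ(K a)`, and `ρ(K a)` is at most a constant times `ρ(a)`
because `ρ` is of local upper type.

*From the residual to the range.* The lower bound `ρ(t) |r_a(t)| / ρ(a) ≥ b` for `t ≥ k a` turns the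
residual estimate into a bound for the sum of `‖P_μ x‖² / ρ(μ)²` over the eigenvalues `μ ≥ k a` of
`T* T`, `P_μ` being the spectral projections, that does not depend on `a`. As `a → 0` this is
Picard's criterion for `x` to lie in the range of `ρ(T* T)` (`mem_range_spectralApply`).
-/

namespace SpectralReg

/-! ### Spectral calculus of a compact self-adjoint operator -/

section Calculus

variable {𝕜 X Y : Type*} [RCLike 𝕜]
  [NormedAddCommGroup X] [InnerProductSpace 𝕜 X] [CompleteSpace X]
  [NormedAddCommGroup Y] [InnerProductSpace 𝕜 Y] [CompleteSpace Y]

theorem orthogonalFamily_real_eigenspaces {A : X →L[𝕜] X} (hs : (A : X →ₗ[𝕜] X).IsSymmetric) :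
    OrthogonalFamily 𝕜 (fun μ : ℝ => Module.End.eigenspace (A : X →ₗ[𝕜] X) (μ : 𝕜))
      fun μ : ℝ => (Module.End.eigenspace (A : X →ₗ[𝕜] X) (μ : 𝕜)).subtypeₗᵢ :=
  hs.orthogonalFamily_eigenspaces.comp (f := fun μ : ℝ => (μ : 𝕜)) RCLike.ofReal_injective

theorem eigenProj_mem (A : X →L[𝕜] X) (μ : ℝ) (x : X) :
    eigenProj A μ x ∈ Module.End.eigenspace (A : X →ₗ[𝕜] X) (μ : 𝕜) :=
  Submodule.starProjection_apply_mem _ x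

theorem apply_eigenProj (A : X →L[𝕜] X) (μ : ℝ) (x : X) :
    A (eigenProj A μ x) = (μ : 𝕜) • eigenProj A μ x :=
  Module.End.mem_eigenspace_iff.1 (eigenProj_mem A μ x)

theorem eigenProj_of_mem {A : X →L[𝕜] X} {μ : ℝ} {x : X}
    (h : x ∈ Module.End.eigenspace (A : X →ₗ[𝕜] X) (μ : 𝕜)) : eigenProj A μ x = x :=
  Submodule.starProjection_eq_self_iff.2 h

theorem eigenProj_idem (A : X →L[𝕜] X) (μ : ℝ) (x : X) :
    eigenProj A μ (eigenProj A μ x) = eigenProj A μ x :=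
  eigenProj_of_mem (eigenProj_mem A μ x)

theorem norm_eigenProj_le (A : X →L[𝕜] X) (μ : ℝ) (x : X) : ‖eigenProj A μ x‖ ≤ ‖x‖ :=
  Submodule.norm_starProjection_apply_le _ x

theorem eigenProj_of_mem_of_ne {A : X →L[𝕜] X} (hs : (A : X →ₗ[𝕜] X).IsSymmetric) {μ ν : ℝ}
    (hμν : μ ≠ ν) {x : X} (h : x ∈ Module.End.eigenspace (A : X →ₗ[𝕜] X) (ν : 𝕜)) :
    eigenProj A μ x = 0 := by
  refine (Submodule.starProjection_apply_eq_zero_iff _).2 fun w hw => ?_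
  exact orthogonalFamily_real_eigenspaces hs hμν ⟨w, hw⟩ ⟨x, h⟩

theorem eigenProj_apply {A : X →L[𝕜] X} (hs : (A : X →ₗ[𝕜] X).IsSymmetric) (μ : ℝ) (x : X) :
    eigenProj A μ (A x) = (μ : 𝕜) • eigenProj A μ x := by
  have hP : ∀ u v : X, inner 𝕜 (eigenProj A μ u) v = inner 𝕜 u (eigenProj A μ v) :=
    Submodule.inner_starProjection_left_eq_right _
  refine ext_inner_right 𝕜 fun v => ?_
  have h1 : inner 𝕜 (A x) (eigenProj A μ v) = inner 𝕜 x (A (eigenProj A μ v)) := hs _ _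
  rw [hP, h1, apply_eigenProj, inner_smul_right, inner_smul_left, RCLike.conj_ofReal, hP]

theorem norm_sum_smul_eigenProj_sq {A : X →L[𝕜] X} (hs : (A : X →ₗ[𝕜] X).IsSymmetric)
    (f : ℝ → ℝ) (x : X) (F : Finset ℝ) :
    ‖∑ μ ∈ F, ((f μ : ℝ) : 𝕜) • eigenProj A μ x‖ ^ 2
      = ∑ μ ∈ F, f μ ^ 2 * ‖eigenProj A μ x‖ ^ 2 := by
  have h := (orthogonalFamily_real_eigenspaces hs).norm_sum
    (fun μ => ((f μ : ℝ) : 𝕜) • ⟨eigenProj A μ x, eigenProj_mem A μ x⟩) F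
  simpa [norm_smul, mul_pow] using h

/-- **Bessel's inequality** for the spectral projections. -/
theorem sum_norm_eigenProj_sq_le {A : X →L[𝕜] X} (hs : (A : X →ₗ[𝕜] X).IsSymmetric)
    (x : X) (F : Finset ℝ) : ∑ μ ∈ F, ‖eigenProj A μ x‖ ^ 2 ≤ ‖x‖ ^ 2 := by
  have h1 : ‖∑ μ ∈ F, eigenProj A μ x‖ ^ 2 = ∑ μ ∈ F, ‖eigenProj A μ x‖ ^ 2 := by
    simpa using norm_sum_smul_eigenProj_sq hs (fun _ => 1) x F
  have h2 : RCLike.re (inner 𝕜 (∑ μ ∈ F, eigenProj A μ x) x)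
      = ∑ μ ∈ F, ‖eigenProj A μ x‖ ^ 2 := by
    rw [sum_inner, map_sum]
    exact Finset.sum_congr rfl fun μ _ => Submodule.re_inner_starProjection_eq_normSq _ x
  have h3 := re_inner_le_norm (𝕜 := 𝕜) (∑ μ ∈ F, eigenProj A μ x) x
  rw [h2, ← h1] at h3
  rw [← h1]
  nlinarith [sq_nonneg (‖∑ μ ∈ F, eigenProj A μ x‖ - ‖x‖)]

theorem summable_smul_eigenProj_iff {A : X →L[𝕜] X} (hs : (A : X →ₗ[𝕜] X).IsSymmetric)
    (f : ℝ → ℝ) (x : X) :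
    Summable (fun μ : ℝ => ((f μ : ℝ) : 𝕜) • eigenProj A μ x)
      ↔ Summable fun μ : ℝ => f μ ^ 2 * ‖eigenProj A μ x‖ ^ 2 := by
  have h := (orthogonalFamily_real_eigenspaces hs).summable_iff_norm_sq_summable
    (fun μ => ((f μ : ℝ) : 𝕜) • ⟨eigenProj A μ x, eigenProj_mem A μ x⟩)
  simpa [norm_smul, mul_pow] using h

/-- The spectral components of `f(A) x`, once its defining series is known to converge (otherwise
`spectralApply` has the junk value `0`). -/
theorem eigenProj_spectralApply {A : X →L[𝕜] X} (hs : (A : X →ₗ[𝕜] X).IsSymmetric)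
    {f : ℝ → ℝ} {x : X} (hf : Summable fun μ : ℝ => ((f μ : ℝ) : 𝕜) • eigenProj A μ x) (ν : ℝ) :
    eigenProj A ν (spectralApply A f x) = ((f ν : ℝ) : 𝕜) • eigenProj A ν x := by
  rw [spectralApply, (eigenProj A ν).map_tsum hf, tsum_eq_single ν]
  · rw [map_smul, eigenProj_idem]
  · intro μ hμ
    rw [map_smul, eigenProj_of_mem_of_ne hs hμ.symm (eigenProj_mem A μ x), smul_zero]

/-- **Spectral theorem**: the spectral projections of a compact self-adjoint operator resolve
the identity. -/
theorem tsum_eigenProj {A : X →L[𝕜] X} (hA : IsCompactOperator A)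
    (hs : (A : X →ₗ[𝕜] X).IsSymmetric) (x : X) : ∑' μ : ℝ, eigenProj A μ x = x := by
  have hsum : Summable fun μ : ℝ => (((fun _ => 1 : ℝ → ℝ) μ : ℝ) : 𝕜) • eigenProj A μ x := by
    rw [summable_smul_eigenProj_iff hs]
    refine summable_of_sum_le (c := ‖x‖ ^ 2) (fun μ => by positivity) fun F => ?_
    simpa using sum_norm_eigenProj_sq_le hs x F
  have hproj := eigenProj_spectralApply hs hsum
  have hone : spectralApply A (fun _ => 1) x = ∑' μ : ℝ, eigenProj A μ x := by
    simp [spectralApply]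
  -- The difference of the two sides is orthogonal to every eigenspace.
  rw [← hone, eq_comm, ← sub_eq_zero, ← Submodule.mem_bot 𝕜,
    ← ContinuousLinearMap.orthogonalComplement_iSup_eigenspaces_eq_bot hA hs,
    ← Submodule.iInf_orthogonal, Submodule.mem_iInf]
  intro μ
  by_cases h : Module.End.HasEigenvalue (A : X →ₗ[𝕜] X) μ
  · obtain ⟨m, rfl⟩ : ∃ m : ℝ, (m : 𝕜) = μ :=
      RCLike.conj_eq_iff_real.1 (hs.conj_eigenvalue_eq_self h) |>.imp fun _ h => h.symm
    refine (Submodule.starProjection_apply_eq_zero_iff _).1 ?_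
    have := hproj m
    rw [RCLike.ofReal_one, one_smul] at this
    change eigenProj A m _ = 0
    rw [map_sub, this, sub_self]
  · rw [Module.End.hasEigenvalue_iff, not_not] at h
    rw [h]
    simp

theorem sum_sq_mul_norm_eigenProj_sq_le {A : X →L[𝕜] X} (hs : (A : X →ₗ[𝕜] X).IsSymmetric)
    {f : ℝ → ℝ} {M : ℝ} (hf : ∀ μ (x : X), eigenProj A μ x ≠ 0 → |f μ| ≤ M) (x : X)
    (F : Finset ℝ) : ∑ μ ∈ F, f μ ^ 2 * ‖eigenProj A μ x‖ ^ 2 ≤ M ^ 2 * ‖x‖ ^ 2 := by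
  refine le_trans (Finset.sum_le_sum (g := fun μ => M ^ 2 * ‖eigenProj A μ x‖ ^ 2) fun μ _ => ?_) ?_
  · by_cases h : eigenProj A μ x = 0
    · simp [h]
    · exact mul_le_mul_of_nonneg_right
        (sq_le_sq.2 ((hf μ x h).trans (le_abs_self M))) (by positivity)
  · rw [← Finset.mul_sum]
    exact mul_le_mul_of_nonneg_left (sum_norm_eigenProj_sq_le hs x F) (by positivity)

theorem summable_smul_eigenProj_of_bounded {A : X →L[𝕜] X} (hs : (A : X →ₗ[𝕜] X).IsSymmetric)
    {f : ℝ → ℝ} {M : ℝ} (hf : ∀ μ (x : X), eigenProj A μ x ≠ 0 → |f μ| ≤ M) (x : X) :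
    Summable fun μ : ℝ => ((f μ : ℝ) : 𝕜) • eigenProj A μ x := by
  rw [summable_smul_eigenProj_iff hs]
  refine summable_of_sum_le (c := M ^ 2 * ‖x‖ ^ 2) (fun μ => by positivity) fun F =>
    sum_sq_mul_norm_eigenProj_sq_le hs hf x F

theorem norm_spectralApply_le {A : X →L[𝕜] X} (hs : (A : X →ₗ[𝕜] X).IsSymmetric)
    {f : ℝ → ℝ} {M : ℝ} (hM : 0 ≤ M) (hf : ∀ μ (x : X), eigenProj A μ x ≠ 0 → |f μ| ≤ M) (x : X) :
    ‖spectralApply A f x‖ ≤ M * ‖x‖ := by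
  refine le_of_tendsto (summable_smul_eigenProj_of_bounded hs hf x).hasSum.norm
    (Eventually.of_forall fun F => ?_)
  refine le_of_sq_le_sq ?_ (by positivity)
  rw [norm_sum_smul_eigenProj_sq hs, mul_pow]
  exact sum_sq_mul_norm_eigenProj_sq_le hs hf x F

/-- **Picard's criterion**: `x` lies in the range of `f(A)` as soon as `f` does not vanish on the
spectrum and the squared norms of the coefficients of `f(A)⁻¹ x` have bounded partial sums. -/
theorem mem_range_spectralApply {A : X →L[𝕜] X} (hA : IsCompactOperator A)
    (hs : (A : X →ₗ[𝕜] X).IsSymmetric) {f : ℝ → ℝ} {x : X}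
    (hf : ∀ μ, eigenProj A μ x ≠ 0 → f μ ≠ 0) {C : ℝ}
    (hC : ∀ F : Finset ℝ, ∑ μ ∈ F, (f μ)⁻¹ ^ 2 * ‖eigenProj A μ x‖ ^ 2 ≤ C) :
    x ∈ range (spectralApply A f) := by
  have hsum : Summable fun μ : ℝ => (((f μ)⁻¹ : ℝ) : 𝕜) • eigenProj A μ x :=
    (summable_smul_eigenProj_iff hs (fun μ => (f μ)⁻¹) x).2
      (summable_of_sum_le (fun μ => by positivity) hC)
  refine ⟨spectralApply A (fun μ => (f μ)⁻¹) x, ?_⟩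
  conv_rhs => rw [← tsum_eigenProj hA hs x]
  refine tsum_congr fun μ => ?_
  rw [eigenProj_spectralApply hs hsum μ, smul_smul]
  by_cases h : eigenProj A μ x = 0
  · simp [h]
  · rw [← RCLike.ofReal_mul, mul_inv_cancel₀ (hf μ h), RCLike.ofReal_one, one_smul]

/-! ### The normal operator -/

theorem isCompactOperator_normalOp {T : X →L[𝕜] Y} (hT : IsCompactOperator T) :
    IsCompactOperator (normalOp T) :=
  hT.clm_comp (ContinuousLinearMap.adjoint T)

theorem isSymmetric_normalOp (T : X →L[𝕜] Y) : (normalOp T : X →ₗ[𝕜] X).IsSymmetric := by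
  intro u v
  simp [normalOp, ContinuousLinearMap.adjoint_inner_left, ContinuousLinearMap.adjoint_inner_right]

/-- The eigenvalues of `T* T`, for injective `T`, lie in `(0, ‖T‖ ^ 2]`. -/
theorem mem_Ioc_of_eigenProj_ne_zero {T : X →L[𝕜] Y} (hinj : Function.Injective T) {μ : ℝ} {x : X}
    (h : eigenProj (normalOp T) μ x ≠ 0) : μ ∈ Ioc 0 (‖T‖ ^ 2) := by
  set u := eigenProj (normalOp T) μ x with hu
  have h1 : ‖T u‖ ^ 2 = μ * ‖u‖ ^ 2 := by
    have h2 := ContinuousLinearMap.apply_norm_sq_eq_inner_adjoint_right T u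
    change ‖T u‖ ^ 2 = RCLike.re (inner 𝕜 u (normalOp T u)) at h2
    rw [h2, hu, apply_eigenProj, inner_smul_right, inner_self_eq_norm_sq_to_K]
    norm_cast
  have hu0 : 0 < ‖u‖ ^ 2 := by positivity
  have hTu : 0 < ‖T u‖ ^ 2 := by
    have : T u ≠ 0 := fun h0 => h (hinj (h0.trans (map_zero T).symm))
    positivity
  have hle : ‖T u‖ ^ 2 ≤ ‖T‖ ^ 2 * ‖u‖ ^ 2 := by
    rw [← mul_pow]
    exact pow_le_pow_left₀ (norm_nonneg _) (T.le_opNorm u) 2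
  rw [h1] at hTu hle
  exact ⟨pos_of_mul_pos_left hTu hu0.le, le_of_mul_le_mul_right hle hu0⟩

end Calculus

/-! ### Lower bounds for the reconstruction error -/

theorem PiecewiseContinuousOn.exists_abs_le {f : ℝ → ℝ} {a b : ℝ}
    (hf : PiecewiseContinuousOn f a b) : ∃ M : ℝ, 0 ≤ M ∧ ∀ t ∈ Icc a b, |f t| ≤ M := by
  have key : ∃ M : ℝ, ∀ t ∈ Icc a b, |f t| ≤ M := by
    refine (isCompact_Icc (a := a) (b := b)).induction_on (p := fun s => ∃ M : ℝ, ∀ t ∈ s, |f t| ≤ M)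
      ⟨0, by simp⟩ (fun s t hst ⟨M, hM⟩ => ⟨M, fun u hu => hM u (hst hu)⟩)
      (fun s t ⟨M, hM⟩ ⟨M', hM'⟩ => ⟨max M M', fun u hu => ?_⟩) fun t ht => ?_
    · rcases hu with hu | hu
      · exact (hM u hu).trans (le_max_left _ _)
      · exact (hM' u hu).trans (le_max_right _ _)
    · obtain ⟨⟨l, hl⟩, ⟨r, hr⟩⟩ := hf.2 t ht
      have h1 := hl.abs.eventually (eventually_le_nhds (lt_add_one |l|))
      have h2 := hr.abs.eventually (eventually_le_nhds (lt_add_one |r|))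
      have h3 : ∀ᶠ u in 𝓝[Icc a b] t,
          |f u| ≤ max (max (|l| + 1) (|r| + 1)) |f t| := by
        rw [eventually_nhdsWithin_iff] at h1 h2 ⊢
        filter_upwards [h1, h2] with u hu1 hu2 hu
        rcases lt_trichotomy u t with h | h | h
        · exact (hu1 ⟨hu, h⟩).trans ((le_max_left _ _).trans (le_max_left _ _))
        · exact h ▸ le_max_right _ _
        · exact (hu2 ⟨hu, h⟩).trans ((le_max_right _ _).trans (le_max_left _ _))
      exact ⟨_, h3, _, fun u hu => hu⟩
  obtain ⟨M, hM⟩ := key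
  exact ⟨max M 0, le_max_right _ _, fun t ht => (hM t ht).trans (le_max_left _ _)⟩

section Regularization

variable {𝕜 X Y : Type*} [RCLike 𝕜]
  [NormedAddCommGroup X] [InnerProductSpace 𝕜 X] [CompleteSpace X]
  [NormedAddCommGroup Y] [InnerProductSpace 𝕜 Y] [CompleteSpace Y]

theorem abs_le_of_eigenProj_ne_zero {T : X →L[𝕜] Y} (hinj : Function.Injective T)
    {f : ℝ → ℝ} {M : ℝ} (hf : ∀ t ∈ Icc 0 (‖T‖ ^ 2), |f t| ≤ M) (μ : ℝ) (x : X)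
    (h : eigenProj (normalOp T) μ x ≠ 0) : |f μ| ≤ M :=
  hf μ (Ioc_subset_Icc_self (mem_Ioc_of_eigenProj_ne_zero hinj h))

theorem adjoint_mem_eigenspace_normalOp {T : X →L[𝕜] Y} {a : ℝ} {v : Y}
    (hv : T (ContinuousLinearMap.adjoint T v) = (a : 𝕜) • v) :
    ContinuousLinearMap.adjoint T v
      ∈ Module.End.eigenspace (normalOp T : X →ₗ[𝕜] X) (a : 𝕜) := by
  rw [Module.End.mem_eigenspace_iff]
  simp [normalOp, hv]

theorem norm_adjoint_sq_of_eigenvector {T : X →L[𝕜] Y} {a : ℝ} {v : Y}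
    (hv : T (ContinuousLinearMap.adjoint T v) = (a : 𝕜) • v) :
    ‖ContinuousLinearMap.adjoint T v‖ ^ 2 = a * ‖v‖ ^ 2 := by
  have h := ContinuousLinearMap.apply_norm_sq_eq_inner_adjoint_right
    (ContinuousLinearMap.adjoint T) v
  rw [ContinuousLinearMap.adjoint_adjoint] at h
  change _ = RCLike.re (inner 𝕜 v (T (ContinuousLinearMap.adjoint T v))) at h
  rw [h, hv, inner_smul_right, inner_self_eq_norm_sq_to_K]
  norm_cast

/-- The spectral components of the error for the data `T x + c v`. -/
theorem eigenProj_error {T : X →L[𝕜] Y} (hinj : Function.Injective T)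
    {g : ℝ → ℝ → ℝ} {α M : ℝ} (hM : ∀ t ∈ Icc 0 (‖T‖ ^ 2), |g α t| ≤ M) (x : X) (v : Y) (c μ : ℝ) :
    eigenProj (normalOp T) μ (regOp T g α (T x + (c : 𝕜) • v) - x)
      = ((g α μ * c : ℝ) : 𝕜) • eigenProj (normalOp T) μ (ContinuousLinearMap.adjoint T v)
        - ((resid g α μ : ℝ) : 𝕜) • eigenProj (normalOp T) μ x := by
  have hs := isSymmetric_normalOp T
  have hN : ContinuousLinearMap.adjoint T (T x) = normalOp T x := rfl
  rw [map_sub, regOp, eigenProj_spectralApply hs (summable_smul_eigenProj_of_bounded hs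
    (fun μ z => abs_le_of_eigenProj_ne_zero hinj hM μ z) _), map_add, map_smul, hN, map_add, map_smul,
    eigenProj_apply hs, resid]
  push_cast
  module

/-- If the perturbation `c v` of the data along an eigenvector of `T T*` is signed so that it does
not interfere with the residual, the error dominates both the residual and the propagated noise. -/
theorem error_lower_bounds {T : X →L[𝕜] Y} (hinj : Function.Injective T)
    {g : ℝ → ℝ → ℝ} {α M : ℝ} (hM : ∀ t ∈ Icc 0 (‖T‖ ^ 2), |g α t| ≤ M) (x : X) {v : Y} {a c : ℝ}
    (hv : T (ContinuousLinearMap.adjoint T v) = (a : 𝕜) • v) (hv1 : ‖v‖ = 1)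
    (hc : c * RCLike.re (inner 𝕜 (ContinuousLinearMap.adjoint T v)
      (eigenProj (normalOp T) a x)) ≤ 0)
    (hr : 0 ≤ resid g α a) (hg : 0 ≤ g α a) :
    (∀ F : Finset ℝ, ∑ μ ∈ F, resid g α μ ^ 2 * ‖eigenProj (normalOp T) μ x‖ ^ 2
        ≤ ‖regOp T g α (T x + (c : 𝕜) • v) - x‖ ^ 2) ∧
      (g α a * c) ^ 2 * a ≤ ‖regOp T g α (T x + (c : 𝕜) • v) - x‖ ^ 2 := by
  have hs := isSymmetric_normalOp T
  have hcomp := eigenProj_error hinj hM x v c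
  have hw := adjoint_mem_eigenspace_normalOp hv
  have hwn := norm_adjoint_sq_of_eigenvector hv
  set w := ContinuousLinearMap.adjoint T v
  set Z := regOp T g α (T x + (c : 𝕜) • v) - x
  set p := eigenProj (normalOp T) a x
  have hexp : ‖eigenProj (normalOp T) a Z‖ ^ 2
      = (g α a * c) ^ 2 * a - 2 * (g α a * resid g α a * (c * RCLike.re (inner 𝕜 w p)))
        + resid g α a ^ 2 * ‖p‖ ^ 2 := by
    rw [hcomp, eigenProj_of_mem hw, @norm_sub_sq 𝕜, norm_smul, norm_smul, inner_smul_left,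
      inner_smul_right, RCLike.conj_ofReal, RCLike.re_ofReal_mul, RCLike.re_ofReal_mul,
      RCLike.norm_ofReal, RCLike.norm_ofReal, mul_pow, mul_pow, sq_abs, sq_abs, hwn, hv1]
    ring
  have hcross : g α a * resid g α a * (c * RCLike.re (inner 𝕜 w p)) ≤ 0 :=
    mul_nonpos_of_nonneg_of_nonpos (mul_nonneg hg hr) hc
  have ha : 0 ≤ (g α a * c) ^ 2 * a := by
    have : 0 ≤ a := by rw [hv1] at hwn; nlinarith [sq_nonneg ‖w‖]
    positivity
  constructor
  · intro F
    refine le_trans (Finset.sum_le_sum fun μ _ => ?_) (sum_norm_eigenProj_sq_le hs Z F)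
    by_cases h : μ = a
    · subst h
      rw [hexp]
      linarith
    · rw [hcomp, eigenProj_of_mem_of_ne hs h hw, smul_zero, zero_sub, norm_neg, norm_smul,
        RCLike.norm_ofReal, mul_pow, sq_abs]
  · have h1 := pow_le_pow_left₀ (norm_nonneg _) (norm_eigenProj_le (normalOp T) a Z) 2
    have h2 : 0 ≤ resid g α a ^ 2 * ‖p‖ ^ 2 := by positivity
    linarith

/-- For noise level `δ`, the worst-case error of the best parameter choice is at least the minimum
of the residual at `α = a` and of `γ₂ δ / √a`, for every small eigenvalue `a` of `T T*`: whatever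
`α` is chosen, the residual is at least that at `a` if `a ≤ α`, and the propagated noise is at least
that at `a` if `α ≤ a`. Both sides are squared, and the residual is tested on a finite set `F` of
eigenvalues. -/
theorem min_le_worst_error {T : X →L[𝕜] Y} (hinj : Function.Injective T)
    {α₀ : ℝ} {g : ℝ → ℝ → ℝ} (hg : IsRegularizingFamily (‖T‖ ^ 2) α₀ g)
    {l₁ γ₂ c₁ : ℝ} (hl₁ : l₁ ≤ ‖T‖ ^ 2) (hγ₂ : 0 < γ₂) (hc₁ : 1 < c₁)
    (hunit : ∀ α ∈ Ioo 0 α₀, ∀ t ∈ Icc 0 l₁, 0 ≤ resid g α t ∧ resid g α t ≤ 1)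
    (hmono : ∀ t ∈ Ioc 0 (‖T‖ ^ 2), MonotoneOn (fun α => |resid g α t|) (Ioo 0 α₀))
    (hlow : ∀ α ∈ Ioo 0 α₀, c₁ * α ≤ l₁ → γ₂ / α ≤ g α (c₁ * α))
    (hanti : ∀ α ∈ Ioo 0 α₀, ∀ s t : ℝ, α ≤ s → s ≤ t → t ≤ l₁ → g α t ≤ g α s)
    {a : ℝ} (ha : a ∈ Ioo 0 α₀) (hal : c₁ * a ≤ l₁)
    (haev : Module.End.HasEigenvalue
      ((T.comp (ContinuousLinearMap.adjoint T) : Y →L[𝕜] Y) : Y →ₗ[𝕜] Y) ((a : ℝ) : 𝕜))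
    (x : X) {δ : ℝ} (hδ : 0 ≤ δ) (F : Finset ℝ) :
    min (∑ μ ∈ F, resid g a μ ^ 2 * ‖eigenProj (normalOp T) μ x‖ ^ 2) (γ₂ ^ 2 * δ ^ 2 / a)
      ≤ (⨆ y : Metric.closedBall (T x) δ, ⨅ α : Ioo 0 α₀, ‖regOp T g α (y : Y) - x‖) ^ 2 := by
  have ha0 : 0 < a := ha.1
  have hal' : a ≤ l₁ := le_trans (by nlinarith) hal
  have haI : a ∈ Ioc 0 (‖T‖ ^ 2) := ⟨ha0, hal'.trans hl₁⟩
  obtain ⟨v₀, hv₀⟩ := haev.exists_hasEigenvector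
  obtain ⟨v, hv1, hv⟩ : ∃ v : Y, ‖v‖ = 1 ∧
      T (ContinuousLinearMap.adjoint T v) = (a : 𝕜) • v := by
    refine ⟨((‖v₀‖⁻¹ : ℝ) : 𝕜) • v₀, ?_, ?_⟩
    · rw [norm_smul, RCLike.norm_ofReal, abs_inv, abs_norm,
        inv_mul_cancel₀ (norm_ne_zero_iff.2 hv₀.2)]
    · have h : T (ContinuousLinearMap.adjoint T v₀) = (a : 𝕜) • v₀ := hv₀.apply_eq_smul
      rw [map_smul, map_smul, h, smul_comm]
  -- The sign of the noise does not depend on `α`, so one `y` in the ball serves for all `α`.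
  obtain ⟨c, hcδ, hc⟩ : ∃ c : ℝ, |c| = δ ∧
      c * RCLike.re (inner 𝕜 (ContinuousLinearMap.adjoint T v)
        (eigenProj (normalOp T) a x)) ≤ 0 := by
    rcases le_total 0 (RCLike.re (inner 𝕜 (ContinuousLinearMap.adjoint T v)
        (eigenProj (normalOp T) a x))) with h | h
    · exact ⟨-δ, by rw [abs_neg, abs_of_nonneg hδ], by nlinarith⟩
    · exact ⟨δ, abs_of_nonneg hδ, by nlinarith⟩
  have hga : γ₂ / a ≤ g a a :=
    (hlow a ha hal).trans (hanti a ha a (c₁ * a) le_rfl (by nlinarith) hal)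
  set m := min (∑ μ ∈ F, resid g a μ ^ 2 * ‖eigenProj (normalOp T) μ x‖ ^ 2)
    (γ₂ ^ 2 * δ ^ 2 / a)
  have hpoint : ∀ α ∈ Ioo 0 α₀, m ≤ ‖regOp T g α (T x + (c : 𝕜) • v) - x‖ ^ 2 := by
    intro α hα
    obtain ⟨M, -, hM⟩ := (hg.piecewise_continuous α hα).exists_abs_le
    obtain ⟨hr0, hr1⟩ := hunit α hα a ⟨ha0.le, hal'⟩
    have hgα : 0 ≤ g α a := by
      rw [resid] at hr1
      exact nonneg_of_mul_nonneg_right (by linarith) ha0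
    obtain ⟨h1, h2⟩ := error_lower_bounds hinj hM x hv hv1 hc hr0 hgα
    rcases le_total a α with h | h
    · refine (min_le_left _ _).trans (le_trans (Finset.sum_le_sum fun μ _ => ?_) (h1 F))
      by_cases h0 : eigenProj (normalOp T) μ x = 0
      · simp [h0]
      · exact mul_le_mul_of_nonneg_right
          (sq_le_sq.2 (hmono μ (mem_Ioc_of_eigenProj_ne_zero hinj h0) ha hα h)) (by positivity)
    · refine (min_le_right _ _).trans (le_trans ?_ h2)
      have hrr : |resid g α a| ≤ |resid g a a| := hmono a haI hα ha h
      rw [abs_of_nonneg hr0, abs_of_nonneg (hunit a ha a ⟨ha0.le, hal'⟩).1, resid, resid] at hrr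
      have hgg : γ₂ / a ≤ g α a := hga.trans (le_of_mul_le_mul_left (by linarith) ha0)
      calc γ₂ ^ 2 * δ ^ 2 / a = (γ₂ / a) ^ 2 * c ^ 2 * a := by
            rw [← sq_abs c, hcδ]; field_simp
        _ ≤ g α a ^ 2 * c ^ 2 * a := by gcongr
        _ = (g α a * c) ^ 2 * a := by ring
  have hm0 : 0 ≤ m := le_min (Finset.sum_nonneg fun μ _ => by positivity) (by positivity)
  have : Nonempty (Ioo 0 α₀) := ⟨⟨a, ha⟩⟩
  have hy : T x + (c : 𝕜) • v ∈ Metric.closedBall (T x) δ := by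
    rw [mem_closedBall_iff_norm, add_sub_cancel_left, norm_smul, RCLike.norm_ofReal, hcδ, hv1,
      mul_one]
  -- Without this bound the real supremum would be the junk value `0`.
  have hbdd : BddAbove (range fun y : Metric.closedBall (T x) δ =>
      ⨅ α : Ioo 0 α₀, ‖regOp T g α (y : Y) - x‖) := by
    obtain ⟨M, hM0, hM⟩ := (hg.piecewise_continuous a ha).exists_abs_le
    refine ⟨M * (‖ContinuousLinearMap.adjoint T‖ * (‖T x‖ + δ)) + ‖x‖, ?_⟩
    rintro _ ⟨y, rfl⟩
    refine (ciInf_le ⟨0, ?_⟩ (⟨a, ha⟩ : Ioo 0 α₀)).trans ((norm_sub_le _ _).trans ?_)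
    · rintro _ ⟨α, rfl⟩
      positivity
    · have hynorm : ‖(y : Y)‖ ≤ ‖T x‖ + δ := by
        have := mem_closedBall_iff_norm.1 y.2
        linarith [norm_le_insert' (y : Y) (T x)]
      have h1 := norm_spectralApply_le (isSymmetric_normalOp T) hM0
        (fun μ z => abs_le_of_eigenProj_ne_zero hinj hM μ z) (ContinuousLinearMap.adjoint T (y : Y))
      have h2 := (ContinuousLinearMap.adjoint T).le_opNorm (y : Y)
      gcongr
      refine h1.trans ?_
      gcongr
      exact h2.trans (by gcongr)
  rw [← Real.sqrt_le_left]
  · refine le_trans (le_ciInf fun α : Ioo 0 α₀ => ?_) (le_ciSup hbdd ⟨_, hy⟩)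
    exact Real.sqrt_le_iff.2 ⟨norm_nonneg _, hpoint α α.2⟩
  · exact Real.iSup_nonneg fun y => Real.iInf_nonneg fun α => norm_nonneg _

end Regularization

/-! ### The index function `Θ` -/

theorem thetaInv_theta {ρ : ℝ → ℝ} {N : ℝ} (hpos : ∀ t ∈ Ioc 0 N, 0 < ρ t)
    (hmono : StrictMonoOn ρ (Ioc 0 N)) {t : ℝ} (ht : t ∈ Ioc 0 N) :
    ThetaInv ρ N (Theta ρ t) = t := by
  have hΘ : StrictMonoOn (Theta ρ) (Ioc 0 N) := fun s hs t ht hst =>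
    mul_lt_mul'' (Real.sqrt_lt_sqrt hs.1.le hst) (hmono hs ht hst) (Real.sqrt_nonneg _)
      (hpos s hs).le
  exact hΘ.injOn.leftInvOn_invFunOn ht

theorem tendsto_theta {ρ : ℝ → ℝ} {N : ℝ} (hN : 0 < N) (hpos : ∀ t ∈ Ioc 0 N, 0 < ρ t)
    (h0 : Tendsto ρ (𝓝[>] 0) (𝓝 0)) : Tendsto (Theta ρ) (𝓝[>] 0) (𝓝[>] 0) := by
  refine tendsto_nhdsWithin_iff.2 ⟨?_, ?_⟩
  · have h : Tendsto (fun t : ℝ => √t) (𝓝[>] 0) (𝓝 0) := by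
      simpa using (Real.continuous_sqrt.tendsto 0).mono_left nhdsWithin_le_nhds
    simpa [Theta] using! h.mul h0
  · filter_upwards [Ioc_mem_nhdsGT hN] with t ht
    exact mul_pos (Real.sqrt_pos.2 ht.1) (hpos t ht)

end SpectralReg

/-! ### The converse result -/

theorem lemma4p11 {𝕜 X Y : Type*} [RCLike 𝕜]
    [NormedAddCommGroup X] [InnerProductSpace 𝕜 X] [CompleteSpace X]
    [NormedAddCommGroup Y] [InnerProductSpace 𝕜 Y] [CompleteSpace Y]
    (T : X →L[𝕜] Y) (hT : IsCompactOperator T) (hinj : Function.Injective T)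
    (α₀ : ℝ) (hα₀ : 0 < α₀) (hα₀' : α₀ ≤ ‖T‖ ^ 2)
    (g : ℝ → ℝ → ℝ) (ρ : ℝ → ℝ)
    (hg : IsRegularizingFamily (‖T‖ ^ 2) α₀ g)
    (hev : EigenvalueCondition T)
    (hres : ResidualConditions (‖T‖ ^ 2) α₀ g)
    (hρ : QualificationConditions (‖T‖ ^ 2) α₀ g ρ)
    (hconv : ∀ α ∈ Ioo 0 α₀, ConvexOn ℝ (Ioc 0 (‖T‖ ^ 2)) fun t => |resid g α t| ^ 2)
    (x : X)
    (hx : (fun δ : ℝ => ⨆ y : Metric.closedBall (T x) δ, ⨅ α : Ioo 0 α₀,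
        ‖regOp T g α (y : Y) - x‖)
      =O[𝓝[>] 0] fun δ : ℝ => ρ (ThetaInv ρ (‖T‖ ^ 2) δ)) :
    x ∈ range (spectralApply (normalOp T) ρ) := by
  obtain ⟨l₁, γ₁, γ₂, c₁, hl₁, hl₁N, -, hγ₂, hc₁, hunit, -, hmono, hlow, hanti⟩ := hres
  obtain ⟨hstrict, ⟨β, hβ⟩, -, b, k, hb, hk, hmax⟩ := hρ
  obtain ⟨ev, -, -, hevT, hevpos, -, hev0, -⟩ := hev
  obtain ⟨d, hd, hdoub⟩ := hβ.le
  obtain ⟨C, hC, hCx⟩ := hx.exists_pos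
  have hN : 0 < ‖T‖ ^ 2 := hα₀.trans_le hα₀'
  -- With `δ = Θ(K a)` the noise term `γ₂ δ / √a = γ₂ √K ρ(K a)` exceeds the bound `C ρ(K a)`.
  set K : ℝ := C ^ 2 / γ₂ ^ 2 + 1 with hK
  have hK1 : 1 ≤ K := by rw [hK]; linarith [show 0 ≤ C ^ 2 / γ₂ ^ 2 by positivity]
  have hK0 : 0 < K := one_pos.trans_le hK1
  have hKC : C ^ 2 < γ₂ ^ 2 * K := by
    rw [hK, mul_add, mul_div_cancel₀ _ (by positivity)]
    linarith [show 0 < γ₂ ^ 2 by positivity]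
  set D : ℝ := d * (1 / (1 / K)) ^ β with hD
  have hscale : ∀ c : ℝ, 0 < c → Tendsto (fun t : ℝ => c * t) (𝓝[>] 0) (𝓝[>] 0) := fun c hc => by
    refine tendsto_nhdsWithin_iff.2 ⟨?_, ?_⟩
    · simpa using (((continuous_const_mul c).tendsto 0).mono_left nhdsWithin_le_nhds :
        Tendsto (fun t : ℝ => c * t) (𝓝[>] 0) _)
    · filter_upwards [self_mem_nhdsWithin] with t ht
      exact mul_pos hc ht
  have hev0' : Tendsto ev atTop (𝓝[>] 0) :=
    tendsto_nhdsWithin_iff.2 ⟨hev0, Eventually.of_forall hevpos⟩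
  have hresid : ∀ᶠ n in atTop, ∀ F : Finset ℝ,
      ∑ μ ∈ F, resid g (ev n) μ ^ 2 * ‖eigenProj (normalOp T) μ x‖ ^ 2
        ≤ (C * D * ρ (ev n)) ^ 2 := by
    have e1 := hev0'.eventually (Ioo_mem_nhdsGT hα₀)
    have e2 := ((hscale c₁ (by linarith)).comp hev0').eventually (Ioc_mem_nhdsGT hl₁)
    have e3 := ((hscale K hK0).comp hev0').eventually (Ioc_mem_nhdsGT hN)
    have e4 := ((tendsto_theta hN hβ.pos hβ.tendsto_zero).comp
      ((hscale K hK0).comp hev0')).eventually (hCx.bound.and self_mem_nhdsWithin)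
    filter_upwards [e1, e2, e3, e4] with n h1 h2 h3 h4 F
    simp only [Function.comp_apply] at h2 h3 h4
    obtain ⟨h4, h5⟩ := h4
    have ha := hevpos n
    set a := ev n
    have hmin := min_le_worst_error hinj hg hl₁N hγ₂ hc₁ hunit hmono hlow hanti h1 h2.2 (hevT n) x
      (le_of_lt h5) F
    rw [thetaInv_theta hβ.pos hstrict h3, Real.norm_of_nonneg (hβ.pos _ h3).le] at h4
    have hub := hmin.trans (sq_le_sq' (by linarith [neg_le_of_abs_le h4]) (le_of_abs_le h4))
    have hρK := hβ.pos _ h3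
    have hnoise : (C * ρ (K * a)) ^ 2 < γ₂ ^ 2 * Theta ρ (K * a) ^ 2 / a := by
      rw [Theta, mul_pow, mul_pow, Real.sq_sqrt h3.1.le]
      calc C ^ 2 * ρ (K * a) ^ 2 < γ₂ ^ 2 * K * ρ (K * a) ^ 2 := by gcongr
        _ = γ₂ ^ 2 * (K * a * ρ (K * a) ^ 2) / a := by field_simp
    have hle := (min_le_iff.1 hub).resolve_right (not_le.2 hnoise)
    refine hle.trans ?_
    have hdd := hdoub (1 / K) ⟨by positivity, (div_le_one hK0).2 hK1⟩ (K * a) h3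
    rw [← hD, show 1 / K * (K * a) = a by field_simp] at hdd
    rw [mul_assoc]
    gcongr
  refine mem_range_spectralApply (isCompactOperator_normalOp hT) (isSymmetric_normalOp T)
    (fun μ h => (hβ.pos μ (mem_Ioc_of_eigenProj_ne_zero hinj h)).ne') (C := (C * D / b) ^ 2)
    fun F => ?_
  -- On a finite set of eigenvalues, `a = ev n` is eventually small enough for maximality.
  have hsmall : ∀ᶠ n in atTop, ∀ μ ∈ F, 0 < μ → k * ev n ≤ μ := by
    refine (Finset.eventually_all F).2 fun μ _ => ?_
    by_cases hμ : 0 < μ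
    · filter_upwards [((hscale k hk).comp hev0').eventually (Ioc_mem_nhdsGT hμ)] with n hn _
      exact hn.2
    · exact Eventually.of_forall fun n h => absurd h hμ
  obtain ⟨n, hn1, hn2, hn3⟩ :=
    (hresid.and (hsmall.and (hev0'.eventually (Ioo_mem_nhdsGT hα₀)))).exists
  have hρa : 0 < ρ (ev n) := hβ.pos _ ⟨hn3.1, hn3.2.le.trans hα₀'⟩
  calc ∑ μ ∈ F, (ρ μ)⁻¹ ^ 2 * ‖eigenProj (normalOp T) μ x‖ ^ 2
      ≤ ∑ μ ∈ F, (1 / (b * ρ (ev n)) ^ 2) *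
          (resid g (ev n) μ ^ 2 * ‖eigenProj (normalOp T) μ x‖ ^ 2) := by
        refine Finset.sum_le_sum fun μ hμ => ?_
        by_cases h0 : eigenProj (normalOp T) μ x = 0
        · simp [h0]
        · have hμI := mem_Ioc_of_eigenProj_ne_zero hinj h0
          have hρμ := hβ.pos μ hμI
          have h := hmax (ev n) hn3 μ (hn2 μ hμ hμI.1) hμI.2
          rw [le_div_iff₀ hρa] at h
          rw [← mul_assoc]
          gcongr
          rw [← sq_abs (resid g (ev n) μ), inv_pow, one_div_mul_eq_div, ← one_div,
            div_le_div_iff₀ (by positivity) (by positivity), one_mul, ← mul_pow]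
          exact pow_le_pow_left₀ (by positivity) (by linarith) 2
    _ = (1 / (b * ρ (ev n)) ^ 2) *
          ∑ μ ∈ F, resid g (ev n) μ ^ 2 * ‖eigenProj (normalOp T) μ x‖ ^ 2 := by
        rw [Finset.mul_sum]
    _ ≤ (1 / (b * ρ (ev n)) ^ 2) * (C * D * ρ (ev n)) ^ 2 := by
        gcongr
        exact hn1 F
    _ = (C * D / b) ^ 2 := by field_simp
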